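/- \textbf{Setting.} Let $\mathcal H$ be a complex Hilbert space and let $\mathcal N_1\subset\mathcal N_2\subset\cdots\subset\mathcal B(\mathcal H)$ be a funnel: every $\mathcal N_n$ is a von Neumann algebra containing $1\in\mathcal B(\mathcal H)$ which is a factor of type I$_\infty$ (i.e. $*$-isomorphic to $\mathcal B(\mathcal K)$ for some infinite dimensional Hilbert space $\mathcal K$), and every relative commutant $\mathcal N_n'\cap\mathcal N_{n+1}$ is infinite dimensional. Put $\mathcal N=\bigcup_n\mathcal N_n$. Let $\Omega\in\mathcal H$ be a generic vector, i.e. a unit vector such that $(\mathcal N_n'\cap\mathcal N_{n+1})\Omega$ is dense in $\mathcal H$ for every $n$, and let $\omega(C)=\langle\Omega,C\Omega\rangle$ for $C\in\mathcal N$. For $A\in\mathcal N$ let $\omega_A(C)=\omega(A^*CA)$, $C\in\mathcal N$, and put $$\omega_{\mathcal N}=\{\omega_A : A\in\mathcal N,\ \omega_A(1)=1\},\qquad \mathcal C=\operatorname{Span}_{\mathbb C}\omega_{\mathcal N},$$ and let $\operatorname{Conv}\omega_{\mathcal N}\subset\mathcal C$ be the (algebraic) convex hull of $\omega_{\mathcal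 N}$. The space $\mathcal C$ carries the antilinear involution $\big(\sum_k c_k\,\omega_{A_k}\big)^\dagger=\sum_k\overline{c_k}\,\omega_{A_k}$, that is, $\psi^\dagger(C)=\overline{\psi(C^*)}$. The transition probability of $\omega_A,\omega_B\in\omega_{\mathcal N}$ is $\omega_A\cdot\omega_B=|\omega(A^*B)|^2$ (it depends only on the states, since $\omega_A=\omega_B$ in $\omega_{\mathcal N}$ forces $B=tA$ with $|t|=1$), and $\omega_A,\omega_B$ are orthogonal if $\omega_A\cdot\omega_B=0$. \textbf{Proposition.} (i) If $\psi\in\mathcal C$ and $\psi=\psi^\dagger$, then there are $M\in\mathbb N_0$, mutually orthogonal states $\omega_{A_1},\dots,\omega_{A_M}\in\omega_{\mathcal N}$ and $r_1,\dots,r_M\in\mathbb R$ such that $\psi=\sum_{m=1}^M r_m\,\omega_{A_m}$ (for $\psi=0$ the sum may be empty). (ii) If $\psi\in\operatorname{Conv}\omega_{\mathcal N}$, then in every decomposition $\psi=\sum_{m=1}^M r_m\,\omega_{A_m}$ with real $r_m$ and mutually orthogonal states $\omega_{A_m}\in\omega_{\mathcal N}$ one has $r_m\ge 0$ for all $m$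 and $\sum_{m=1}^M r_m=1$. (iii) Consequently every "mixed state" $\psi\in\operatorname{Conv}\omega_{\mathcal N}$ is a convex combination of mutually orthogonal "pure states" in $\omega_{\mathcal N}$. -/

import Mathlib

universe u

/-- A von Neumann algebra is a factor of type `I_∞` if it is `*`-isomorphic to the algebra of all
bounded operators on some infinite dimensional Hilbert space. -/
def IsTypeIInfFactor {H : Type u} [NormedAddCommGroup H] [InnerProductSpace ℂ H] [CompleteSpace H]
    (M : VonNeumannAlgebra H) : Prop :=
  ∃ (K : Type u) (_ : NormedAddCommGroup K) (_ : InnerProductSpace ℂ K) (_ : CompleteSpace K),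
    ¬ FiniteDimensional ℂ K ∧ Nonempty (M.toStarSubalgebra ≃⋆ₐ[ℂ] (K →L[ℂ] K))

/-- The relative commutant `M₁' ∩ M₂` of von Neumann algebras on `H`. -/
noncomputable def relativeCommutant {H : Type u} [NormedAddCommGroup H] [InnerProductSpace ℂ H]
    [CompleteSpace H] (M₁ M₂ : VonNeumannAlgebra H) : StarSubalgebra ℂ (H →L[ℂ] H) :=
  M₁.commutant.toStarSubalgebra ⊓ M₂.toStarSubalgebra

/-- A (proper sequential type `I_∞`) funnel on `H`: an increasing sequence of type `I_∞` factors
with common identity `1 ∈ B(H)` and with infinite dimensional relative commutants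
`N_n' ∩ N_{n+1}`. -/
structure Funnel (H : Type u) [NormedAddCommGroup H] [InnerProductSpace ℂ H]
    [CompleteSpace H] where
  /-- The local algebras `N_n`. -/
  loc : ℕ → VonNeumannAlgebra H
  typeI : ∀ n, IsTypeIInfFactor (loc n)
  le_succ : ∀ n, loc n ≤ loc (n + 1)
  proper : ∀ n, ¬ FiniteDimensional ℂ (relativeCommutant (loc n) (loc (n + 1)))

namespace Funnel

variable {H : Type u} [NormedAddCommGroup H] [InnerProductSpace ℂ H] [CompleteSpace H]

theorem mem_of_le (N : Funnel H) {m n : ℕ} (h : m ≤ n) {A : H →L[ℂ] H} (hA : A ∈ N.loc m) :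
    A ∈ N.loc n := by
  induction n, h using Nat.le_induction with
  | base => exact hA
  | succ k _ ih => exact N.le_succ k ih

/-- The `*`-algebra `𝒩 = ⋃ₙ N_n` generated by a funnel. -/
noncomputable def alg (N : Funnel H) : StarSubalgebra ℂ (H →L[ℂ] H) where
  carrier := {A | ∃ n, A ∈ N.loc n}
  mul_mem' := by
    rintro A B ⟨m, hA⟩ ⟨n, hB⟩
    exact ⟨max m n, mul_mem (N.mem_of_le (le_max_left m n) hA)
      (N.mem_of_le (le_max_right m n) hB)⟩
  add_mem' := by
    rintro A B ⟨m, hA⟩ ⟨n, hB⟩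
    exact ⟨max m n, add_mem (N.mem_of_le (le_max_left m n) hA)
      (N.mem_of_le (le_max_right m n) hB)⟩
  algebraMap_mem' c := ⟨0, (N.loc 0).algebraMap_mem' c⟩
  star_mem' := by
    rintro A ⟨n, hA⟩
    exact ⟨n, star_mem hA⟩

theorem mem_alg (N : Funnel H) {A : H →L[ℂ] H} : A ∈ N.alg ↔ ∃ n, A ∈ N.loc n := Iff.rfl

/-- `Ω` is a generic vector for the funnel: a unit vector which is cyclic for each of the relative
commutants `N_n' ∩ N_{n+1}`. -/
structure IsGeneric (N : Funnel H) (Ω : H) : Prop where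
  norm_eq_one : ‖Ω‖ = 1
  cyclic : ∀ n, Dense {x : H | ∃ X ∈ relativeCommutant (N.loc n) (N.loc (n + 1)), X Ω = x}

/-- The vector functional `ω(C) = ⟨Ω, C Ω⟩` on `𝒩`. -/
noncomputable def state (N : Funnel H) (Ω : H) : N.alg →ₗ[ℂ] ℂ where
  toFun C := inner ℂ Ω ((C : H →L[ℂ] H) Ω)
  map_add' C D := by simp
  map_smul' c C := by simp

/-- The adjoint action `Ad A (C) = A* C A` of `A ∈ 𝒩` on `𝒩`. -/
noncomputable def Ad (N : Funnel H) (A : N.alg) : N.alg →ₗ[ℂ] N.alg where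
  toFun C := star A * C * A
  map_add' C D := by simp [mul_add, add_mul]
  map_smul' c C := by simp

/-- The functional `ω_A = ω ∘ Ad A`. -/
noncomputable def excitation (N : Funnel H) (Ω : H) (A : N.alg) : N.alg →ₗ[ℂ] ℂ :=
  N.state Ω ∘ₗ N.Ad A

/-- The set `ω_𝒩` of local excitations: all `ω_A`, `A ∈ 𝒩`, with `ω_A(1) = 1`. -/
def excitations (N : Funnel H) (Ω : H) : Set (N.alg →ₗ[ℂ] ℂ) :=
  {φ | ∃ A : N.alg, φ = N.excitation Ω A ∧ N.excitation Ω A 1 = 1}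

/-- The convex hull `Conv ω_𝒩`. -/
def conv (N : Funnel H) (Ω : H) : Set (N.alg →ₗ[ℂ] ℂ) :=
  convexHull ℝ (N.excitations Ω)

/-- The complex linear span `𝒞 = Span ω_𝒩`. -/
noncomputable def stateSpan (N : Funnel H) (Ω : H) : Submodule ℂ (N.alg →ₗ[ℂ] ℂ) :=
  Submodule.span ℂ (N.excitations Ω)

theorem excitation_apply (N : Funnel H) (Ω : H) (A C : N.alg) :
    N.excitation Ω A C
      = inner ℂ ((A : H →L[ℂ] H) Ω) ((C : H →L[ℂ] H) ((A : H →L[ℂ] H) Ω)) := by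
  simp [excitation, state, Ad, ContinuousLinearMap.star_eq_adjoint,
    ContinuousLinearMap.adjoint_inner_right]

theorem state_star_mul (N : Funnel H) (Ω : H) (A B : N.alg) :
    N.state Ω (star A * B) = inner ℂ ((A : H →L[ℂ] H) Ω) ((B : H →L[ℂ] H) Ω) := by
  simp [state, ContinuousLinearMap.star_eq_adjoint, ContinuousLinearMap.adjoint_inner_right]

/-- The antilinear involution `ψ ↦ ψ†`, `ψ†(C) = conj (ψ(C*))`. By `dagger_sum` below it is the
map `∑ c_k ω_{A_k} ↦ ∑ conj(c_k) ω_{A_k}` on `𝒞`. -/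
noncomputable def dagger (N : Funnel H) :
    (N.alg →ₗ[ℂ] ℂ) →ₗ⋆[ℂ] (N.alg →ₗ[ℂ] ℂ) where
  toFun φ :=
    { toFun := fun C => star (φ (star C))
      map_add' := fun C D => by simp
      map_smul' := fun c C => by simp }
  map_add' φ χ := by ext C; simp
  map_smul' c φ := by ext C; simp

theorem dagger_excitation (N : Funnel H) (Ω : H) (A : N.alg) :
    N.dagger (N.excitation Ω A) = N.excitation Ω A := by
  ext C
  change star (N.excitation Ω A (star C)) = _
  rw [excitation_apply, excitation_apply]
  simp [ContinuousLinearMap.star_eq_adjoint, ContinuousLinearMap.adjoint_inner_right]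

theorem dagger_sum (N : Funnel H) (Ω : H) {K : ℕ} (c : Fin K → ℂ) (A : Fin K → N.alg) :
    N.dagger (∑ k, c k • N.excitation Ω (A k)) = ∑ k, star (c k) • N.excitation Ω (A k) := by
  simp [map_sum, LinearMap.map_smulₛₗ, dagger_excitation]

/-- The transition probability `ω_A · ω_B = |ω(A* B)|²` of states in `ω_𝒩`. By
`transitionProb_eq` below it does not depend on the operators which represent the states. -/
noncomputable def transitionProb (N : Funnel H) (Ω : H) (φ χ : N.excitations Ω) : ℝ :=
  ‖N.state Ω (star φ.2.choose * χ.2.choose)‖ ^ 2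

/-- Two states in `ω_𝒩` are orthogonal if their transition probability vanishes. -/
def IsOrthogonal (N : Funnel H) (Ω : H) (φ χ : N.excitations Ω) : Prop :=
  N.transitionProb Ω φ χ = 0

theorem star_mul_mul_eq (N : Funnel H) {Ω : H} (hΩ : N.IsGeneric Ω) {A B : N.alg}
    (h : N.excitation Ω A = N.excitation Ω B) (C : N.alg) :
    star A * C * A = star B * C * B := by
  obtain ⟨a, ha⟩ := A.2
  obtain ⟨b, hb⟩ := B.2
  obtain ⟨n, han, hbn⟩ : ∃ n, (A : H →L[ℂ] H) ∈ N.loc n ∧ (B : H →L[ℂ] H) ∈ N.loc n :=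
    ⟨max a b, N.mem_of_le (le_max_left a b) ha, N.mem_of_le (le_max_right a b) hb⟩
  have comm : ∀ D : N.alg, (D : H →L[ℂ] H) ∈ N.loc n → ∀ X Y : H →L[ℂ] H,
      X ∈ relativeCommutant (N.loc n) (N.loc (n + 1)) →
      Y ∈ relativeCommutant (N.loc n) (N.loc (n + 1)) →
      ∃ Z : N.alg, (Z : H →L[ℂ] H) = star X * (C : H →L[ℂ] H) * Y ∧
      inner ℂ (X Ω) (((star D * C * D : N.alg) : H →L[ℂ] H) (Y Ω)) = N.excitation Ω D Z := by
    intro D hD X Y hX hY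
    have hXc := fun v : H => congrArg (fun T : H →L[ℂ] H => T v)
      (VonNeumannAlgebra.mem_commutant_iff.1 hX.1 (D : H →L[ℂ] H) hD)
    have hYc := fun v : H => congrArg (fun T : H →L[ℂ] H => T v)
      (VonNeumannAlgebra.mem_commutant_iff.1 hY.1 (D : H →L[ℂ] H) hD)
    refine ⟨⟨star X * (C : H →L[ℂ] H) * Y, mul_mem (mul_mem (star_mem ⟨n + 1, hX.2⟩) C.2)
      ⟨n + 1, hY.2⟩⟩, rfl, ?_⟩
    rw [excitation_apply]
    simp only [mul_apply_eq_comp] at hXc hYc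
    simp [ContinuousLinearMap.star_eq_adjoint, ContinuousLinearMap.adjoint_inner_right, hXc, hYc]
  have key : ((star A * C * A : N.alg) : H →L[ℂ] H) = ((star B * C * B : N.alg) : H →L[ℂ] H) := by
    apply ContinuousLinearMap.ext_on (hΩ.cyclic n |>.mono Submodule.subset_span)
    rintro _ ⟨Y, hY, rfl⟩
    refine (hΩ.cyclic n).eq_of_inner_right (𝕜 := ℂ) ?_
    rintro _ ⟨X, hX, rfl⟩
    obtain ⟨Z, hZ, e⟩ := comm A han X Y hX hY
    obtain ⟨Z', hZ', e'⟩ := comm B hbn X Y hX hY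
    rw [e, e', h, Subtype.ext (hZ.trans hZ'.symm)]
  exact Subtype.ext key

/-- Operators which induce the same state in `ω_𝒩` differ only by a phase factor. -/
theorem exists_phase (N : Funnel H) {Ω : H} (hΩ : N.IsGeneric Ω) {A B : N.alg}
    (hA : N.excitation Ω A 1 = 1) (h : N.excitation Ω A = N.excitation Ω B) :
    ∃ t : ℂ, ‖t‖ = 1 ∧ B = t • A := by
  have hB : N.excitation Ω B 1 = 1 := h ▸ hA
  obtain ⟨k, hk⟩ := A.2
  obtain ⟨l, hl⟩ := B.2
  obtain ⟨n, han, hbn⟩ : ∃ n, (A : H →L[ℂ] H) ∈ N.loc n ∧ (B : H →L[ℂ] H) ∈ N.loc n :=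
    ⟨max k l, N.mem_of_le (le_max_left k l) hk, N.mem_of_le (le_max_right k l) hl⟩
  obtain ⟨K, _, _, _, -, ⟨π⟩⟩ := N.typeI n
  let A' : (N.loc n).toStarSubalgebra := ⟨A, han⟩
  let B' : (N.loc n).toStarSubalgebra := ⟨B, hbn⟩
  have hc : ∀ c : K →L[ℂ] K, star (π A') * c * π A' = star (π B') * c * π B' := by
    intro c
    have e := N.star_mul_mul_eq hΩ h ⟨(π.symm c : H →L[ℂ] H), n, (π.symm c).2⟩
    have e' : star A' * π.symm c * A' = star B' * π.symm c * B' :=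
      by
      have e1 := congrArg (fun T : N.alg => (T : H →L[ℂ] H)) e
      exact Subtype.ext e1
    simpa [map_star] using congrArg π e'
  have hv : ∀ x y z : K, inner ℂ (star (π A') y) z • star (π A') x
      = inner ℂ (star (π B') y) z • star (π B') x := by
    intro x y z
    have e := congrArg (fun T : K →L[ℂ] K => T z) (hc (InnerProductSpace.rankOne ℂ x y))
    simpa [ContinuousLinearMap.star_eq_adjoint, ContinuousLinearMap.adjoint_inner_left] using e
  have hB0 : star (π B') ≠ 0 := by
    intro h0
    have h1 : B' = 0 := by simpa using h0
    have h2 : (B : H →L[ℂ] H) = 0 := congrArg Subtype.val h1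
    rw [excitation_apply, h2] at hB
    simp at hB
  obtain ⟨y, hy⟩ : ∃ y, star (π B') y ≠ 0 := by
    by_contra! h0
    exact hB0 (ContinuousLinearMap.ext h0)
  have hy' : inner ℂ (star (π B') y) (star (π B') y) ≠ 0 := inner_self_ne_zero.2 hy
  obtain ⟨s, hs⟩ : ∃ s : ℂ, star (π B') = s • star (π A') := by
    refine ⟨(inner ℂ (star (π B') y) (star (π B') y))⁻¹
      * inner ℂ (star (π A') y) (star (π B') y), ContinuousLinearMap.ext fun x => ?_⟩
    rw [smul_apply, mul_smul, hv x y, smul_smul, inv_mul_cancel₀ hy', one_smul]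
  have hBA : B = star s • A := by
    have h1 : π B' = π (star s • A') := by
      rw [← star_star (π B'), hs, star_smul, star_star, map_smul]
    have h2 : (B : H →L[ℂ] H) = star s • (A : H →L[ℂ] H) := congrArg Subtype.val (π.injective h1)
    exact Subtype.ext h2
  refine ⟨star s, ?_, hBA⟩
  rw [excitation_apply] at hA hB
  have h3 : (B : H →L[ℂ] H) Ω = star s • (A : H →L[ℂ] H) Ω := by rw [hBA]; rfl
  have nA : ‖(A : H →L[ℂ] H) Ω‖ = 1 := by
    have h4 : ‖(A : H →L[ℂ] H) Ω‖ = 1 ∨ ‖(A : H →L[ℂ] H) Ω‖ = -1 := by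
      simpa [inner_self_eq_norm_sq_to_K, ← Complex.ofReal_pow] using hA
    exact h4.resolve_right (by linarith [norm_nonneg ((A : H →L[ℂ] H) Ω)])
  have nB : ‖(B : H →L[ℂ] H) Ω‖ = 1 := by
    have h4 : ‖(B : H →L[ℂ] H) Ω‖ = 1 ∨ ‖(B : H →L[ℂ] H) Ω‖ = -1 := by
      simpa [inner_self_eq_norm_sq_to_K, ← Complex.ofReal_pow] using hB
    exact h4.resolve_right (by linarith [norm_nonneg ((B : H →L[ℂ] H) Ω)])
  rw [h3, norm_smul, nA, mul_one] at nB
  exact nB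

theorem transitionProb_eq (N : Funnel H) {Ω : H} (hΩ : N.IsGeneric Ω) (A B : N.alg)
    (hA : N.excitation Ω A 1 = 1) (hB : N.excitation Ω B 1 = 1) :
    N.transitionProb Ω ⟨N.excitation Ω A, A, rfl, hA⟩ ⟨N.excitation Ω B, B, rfl, hB⟩
      = ‖N.state Ω (star A * B)‖ ^ 2 := by
  have key : ∀ φ χ : N.excitations Ω, φ.1 = N.excitation Ω A → χ.1 = N.excitation Ω B →
      N.transitionProb Ω φ χ = ‖N.state Ω (star A * B)‖ ^ 2 := by
    intro φ χ hφ hχ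
    obtain ⟨s, hs, es⟩ := N.exists_phase hΩ hA (hφ.symm.trans φ.2.choose_spec.1)
    obtain ⟨t, ht, et⟩ := N.exists_phase hΩ hB (hχ.symm.trans χ.2.choose_spec.1)
    rw [transitionProb, es, et]
    simp [hs, ht]
  exact key _ _ rfl rfl

end Funnel

/-! Existence: a self-adjoint `ψ` is a real combination of vector functionals at `v k = A k Ω`,
encoded by the finite-rank symmetric operator `∑ r k |v k⟩⟨v k|`. Its eigenvectors lie in the span
of the `v k`, hence are again of the form `B Ω` with `B` in the algebra
(`exists_orthonormal_sum_inner_eq`).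

Positivity cannot be read off by testing `ψ` on eigenprojections, which need not lie in the algebra.
Instead, genericity lifts a relation between the functionals to one between the maps `Ad A`
(`sum_star_mul_mul_eq_zero`). Inside `B(K)`, rank-one test operators turn it into `∑ c i * conj (f
(a i)) * g (a i) = 0` for all matrix coefficients `f`, `g`. These separate operators, and
orthogonality makes the `A m` linearly independent, so some `f` is dual to `A m`; with `g = f` this
gives `r m = ∑ p k * |f (b k)|² ≥ 0` (`nonneg_of_sum_star_mul_mul_eq`). -/

/-! ### Diagonalisation of Hermitian sums and dual elements. -/

section LinearAlgebra

open Module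

/-- A Hermitian combination of vector functionals can be diagonalised by an orthonormal family in
the span of the vectors. -/
theorem exists_orthonormal_sum_inner_eq {H ι : Type*} [NormedAddCommGroup H]
    [InnerProductSpace ℂ H] [Fintype ι] (v : ι → H) (r : ι → ℝ) :
    ∃ (M : ℕ) (e : Fin M → H) (s : Fin M → ℝ), Orthonormal ℂ e ∧
      (∀ m, e m ∈ Submodule.span ℂ (Set.range v)) ∧
      ∀ C : H →L[ℂ] H, ∑ k, (r k : ℂ) * inner ℂ (v k) (C (v k))
        = ∑ m, (s m : ℂ) * inner ℂ (e m) (C (e m)) := by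
  set W := Submodule.span ℂ (Set.range v)
  have : FiniteDimensional ℂ W := FiniteDimensional.span_of_finite ℂ (Set.finite_range v)
  let w : ι → W := fun k => ⟨v k, Submodule.subset_span ⟨k, rfl⟩⟩
  let T : W →ₗ[ℂ] W :=
    ∑ k, (r k : ℂ) • (InnerProductSpace.rankOne ℂ (w k) (w k)).toLinearMap
  have hTa (x : W) : T x = ∑ k, (r k : ℂ) • inner ℂ (w k) x • w k := by
    simp [T]
  have hT : T.IsSymmetric := by
    intro x y
    rw [hTa, hTa, sum_inner, inner_sum]
    refine Finset.sum_congr rfl fun k _ => ?_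
    simp only [inner_smul_left, inner_smul_right, Complex.conj_ofReal, inner_conj_symm]
    ring
  let b := hT.eigenvectorBasis rfl
  let s := hT.eigenvalues rfl
  have horth : Orthonormal ℂ (fun m => (b m : H)) :=
    b.orthonormal.comp_linearIsometry W.subtypeₗᵢ
  refine ⟨_, fun m => (b m : H), s, horth, fun m => (b m).2, fun C => ?_⟩
  have hv (k : ι) : v k = ∑ m, inner ℂ (b m) (w k) • (b m : H) := by
    have h := congrArg (fun x : W => (x : H)) (b.sum_repr' (w k))
    simpa using h.symm
  -- The left side is the matrix entry `⟨b m, T (b l)⟩`, which is diagonal in the eigenbasis.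
  have hδ (l m) : ∑ k, (r k : ℂ) * (inner ℂ (w k) (b l) * inner ℂ (b m) (w k))
      = if m = l then (s l : ℂ) else 0 := by
    have h1 : inner ℂ (b m) (T (b l)) = if m = l then (s l : ℂ) else 0 := by
      rw [hT.apply_eigenvectorBasis, inner_smul_right, orthonormal_iff_ite.1 b.orthonormal]
      simp [s]
    rw [← h1, hTa, inner_sum]
    simp only [inner_smul_right]
  calc ∑ k, (r k : ℂ) * inner ℂ (v k) (C (v k))
      = ∑ k, ∑ l, ∑ m, ((r k : ℂ) * (inner ℂ (w k) (b l) * inner ℂ (b m) (w k)))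
          * inner ℂ (b l : H) (C (b m)) := by
        refine Finset.sum_congr rfl fun k _ => ?_
        rw [hv k, map_sum, sum_inner, Finset.mul_sum]
        refine Finset.sum_congr rfl fun l _ => ?_
        rw [inner_sum, Finset.mul_sum]
        refine Finset.sum_congr rfl fun m _ => ?_
        rw [map_smul, inner_smul_left, inner_smul_right, inner_conj_symm]
        ring
    _ = ∑ l, ∑ m, (∑ k, (r k : ℂ) * (inner ℂ (w k) (b l) * inner ℂ (b m) (w k)))
          * inner ℂ (b l : H) (C (b m)) := by
        rw [Finset.sum_comm]
        refine Finset.sum_congr rfl fun l _ => ?_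
        rw [Finset.sum_comm]
        simp_rw [Finset.sum_mul]
    _ = _ := by
        simp_rw [hδ]
        simp

/-- A separating space of functionals contains a dual element to each member of a finite linearly
independent family. -/
theorem LinearIndependent.exists_mem_dual_eq_single {𝕜 E ι : Type*} [Field 𝕜] [AddCommGroup E]
    [Module 𝕜 E] [Fintype ι] [DecidableEq ι] {a : ι → E} (ha : LinearIndependent 𝕜 a)
    (F : Submodule 𝕜 (Dual 𝕜 E)) (hF : ∀ x, (∀ f ∈ F, f x = 0) → x = 0) (m : ι) :
    ∃ f ∈ F, ∀ k, f (a k) = Pi.single (M := fun _ => 𝕜) m 1 k := by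
  let ev : Dual 𝕜 E →ₗ[𝕜] (ι → 𝕜) := LinearMap.pi fun k => Dual.eval 𝕜 E (a k)
  -- A nonzero `g` vanishing on a proper image would give a linear combination of the `a k` killed
  -- by all of `F`, hence zero, against independence.
  have htop : F.map ev = ⊤ := by
    by_contra hne
    obtain ⟨g, hg0, hg⟩ := Submodule.exists_le_ker_of_lt_top _ (lt_top_iff_ne_top.2 hne)
    have hgs (y : ι → 𝕜) : g y = ∑ k, y k * g (Pi.single k 1) := by
      conv_lhs => rw [pi_eq_sum_univ' y, map_sum]
      refine Finset.sum_congr rfl fun k _ => ?_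
      rw [map_smul, smul_eq_mul]
    have h0 : ∑ k, g (Pi.single k 1) • a k = 0 := by
      refine hF _ fun f hf => ?_
      have h1 : g (ev f) = 0 := hg (Submodule.mem_map_of_mem hf)
      rw [hgs] at h1
      simpa [ev, mul_comm] using h1
    have h2 := Fintype.linearIndependent_iff.1 ha _ h0
    exact hg0 (LinearMap.ext fun y => by simp [hgs y, h2])
  obtain ⟨f, hf, hfe⟩ : Pi.single m 1 ∈ F.map ev := htop ▸ Submodule.mem_top
  exact ⟨f, hf, fun k => congrFun hfe k⟩

end LinearAlgebra

/-! ### Positivity of coefficients in `B(K)`. -/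

section Operators

variable {K : Type*} [NormedAddCommGroup K] [InnerProductSpace ℂ K]

/-- The span of the functionals `T ↦ ⟨y, T w⟩` on `B(K)`. -/
noncomputable def matrixCoefficients (K : Type*) [NormedAddCommGroup K] [InnerProductSpace ℂ K] :
    Submodule ℂ (Module.Dual ℂ (K →L[ℂ] K)) :=
  Submodule.span ℂ {f | ∃ y w : K, ∀ T, f T = inner ℂ y (T w)}

theorem eq_zero_of_matrixCoefficients (T : K →L[ℂ] K)
    (h : ∀ f ∈ matrixCoefficients K, f T = 0) : T = 0 := by
  refine ContinuousLinearMap.ext fun w => ext_inner_left ℂ fun y => ?_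
  let f : Module.Dual ℂ (K →L[ℂ] K) :=
    { toFun := fun S => inner ℂ y (S w)
      map_add' := fun S S' => by simp
      map_smul' := fun c S => by simp }
  simpa [f] using h f (Submodule.subset_span ⟨y, w, fun _ => rfl⟩)

/-- For `f = ⟨x, · z⟩` and `g = ⟨y, · w⟩`, take `D = |x⟩⟨y|` and the matrix element between `z` and
`w`. The general case follows since the sum is antilinear in `f` and linear in `g`. -/
theorem sum_star_mul_eq_zero_of_matrixCoefficients [CompleteSpace K] {ι : Type*} [Fintype ι]
    {c : ι → ℂ} {a : ι → K →L[ℂ] K} (h : ∀ D, ∑ i, c i • (star (a i) * D * a i) = 0)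
    {f g : Module.Dual ℂ (K →L[ℂ] K)} (hf : f ∈ matrixCoefficients K)
    (hg : g ∈ matrixCoefficients K) : ∑ i, c i * (star (f (a i)) * g (a i)) = 0 := by
  induction hf using Submodule.span_induction with
  | zero => simp
  | add f₁ f₂ _ _ h₁ h₂ =>
    simpa [add_mul, mul_add, Finset.sum_add_distrib] using congrArg₂ (· + ·) h₁ h₂
  | smul t f _ hf =>
    have h2 := congrArg (star t * ·) hf
    rw [Finset.mul_sum, mul_zero] at h2
    rw [← h2]
    refine Finset.sum_congr rfl fun i _ => ?_
    simp
    ring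
  | mem f hf =>
    obtain ⟨x, z, hf⟩ := hf
    induction hg using Submodule.span_induction with
    | zero => simp
    | add g₁ g₂ _ _ h₁ h₂ =>
      simpa [mul_add, Finset.sum_add_distrib] using congrArg₂ (· + ·) h₁ h₂
    | smul t g _ hg =>
      have h2 := congrArg (t * ·) hg
      rw [Finset.mul_sum, mul_zero] at h2
      rw [← h2]
      refine Finset.sum_congr rfl fun i _ => ?_
      simp
      ring
    | mem g hg =>
      obtain ⟨y, w, hg⟩ := hg
      have e := congrArg (fun T : K →L[ℂ] K => inner ℂ z (T w))
        (h (InnerProductSpace.rankOne ℂ x y))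
      simp only [sum_apply, inner_sum, smul_apply,
        inner_smul_right, zero_apply, inner_zero_right] at e
      rw [← e]
      refine Finset.sum_congr rfl fun i _ => ?_
      simp [hf, hg, ContinuousLinearMap.star_eq_adjoint, ContinuousLinearMap.adjoint_inner_right,
        inner_smul_right, mul_comm]

/-- If `∑ r_m a_m* D a_m = ∑ p_k b_k* D b_k` for all `D` in `B(K)`, with `p_k ≥ 0` and linearly
independent operators `a_m`, then `r_m ≥ 0`. -/
theorem nonneg_of_sum_star_mul_mul_eq [CompleteSpace K] {ι κ : Type*} [Fintype ι] [Fintype κ]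
    {r : ι → ℝ} {p : κ → ℝ} (hp : ∀ k, 0 ≤ p k) {a : ι → K →L[ℂ] K} {b : κ → K →L[ℂ] K}
    (ha : LinearIndependent ℂ a)
    (h : ∀ D, ∑ i, (r i : ℂ) • (star (a i) * D * a i) = ∑ k, (p k : ℂ) • (star (b k) * D * b k))
    (m : ι) : 0 ≤ r m := by
  classical
  obtain ⟨f, hf, hfa⟩ :=
    ha.exists_mem_dual_eq_single (matrixCoefficients K) eq_zero_of_matrixCoefficients m
  -- Both families form one vanishing relation, the `b k` carrying weights `-p k`; the dual
  -- functional `f` is used in both slots.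
  have e := sum_star_mul_eq_zero_of_matrixCoefficients
    (c := Sum.elim (fun i => (r i : ℂ)) fun k => -(p k : ℂ)) (a := Sum.elim a b)
    (fun D => by
      simp only [Fintype.sum_sum_type, Sum.elim_inl, Sum.elim_inr, h D, neg_smul,
        Finset.sum_neg_distrib, add_neg_cancel]) hf hf
  have e' : (r m : ℂ) = ((∑ k, p k * ‖f (b k)‖ ^ 2 : ℝ) : ℂ) := by
    have e2 : (r m : ℂ) - ∑ k, (p k : ℂ) * (star (f (b k)) * f (b k)) = 0 := by
      simpa [hfa, Pi.single_apply, sub_eq_add_neg] using e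
    rw [sub_eq_zero.1 e2]
    push_cast
    refine Finset.sum_congr rfl fun k _ => ?_
    rw [← Complex.conj_mul']
    rfl
  rw [Complex.ofReal_inj.1 e']
  exact Finset.sum_nonneg fun k _ => mul_nonneg (hp k) (sq_nonneg _)

end Operators

/-! ### Transfer to the funnel and the decomposition of states. -/

namespace Funnel

variable {H : Type u} [NormedAddCommGroup H] [InnerProductSpace ℂ H] [CompleteSpace H]

theorem exists_forall_mem_loc (N : Funnel H) {ι : Type*} [Fintype ι] (A : ι → N.alg) :
    ∃ n, ∀ i, (A i : H →L[ℂ] H) ∈ N.loc n := by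
  choose d hd using fun i => N.mem_alg.1 (A i).2
  exact ⟨Finset.univ.sup d, fun i => N.mem_of_le (Finset.le_sup (Finset.mem_univ i)) (hd i)⟩

/-- A linear relation between the functionals `ω_A` is a relation between the maps `Ad A`. -/
theorem sum_star_mul_mul_eq_zero (N : Funnel H) {Ω : H} (hΩ : N.IsGeneric Ω) {ι : Type*}
    [Fintype ι] (c : ι → ℂ) (A : ι → N.alg) (h : ∑ i, c i • N.excitation Ω (A i) = 0)
    (C : N.alg) : ∑ i, c i • (star (A i) * C * A i) = 0 := by
  obtain ⟨n, hA⟩ := N.exists_forall_mem_loc A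
  refine Subtype.ext ?_
  apply ContinuousLinearMap.ext_on (hΩ.cyclic n |>.mono Submodule.subset_span)
  rintro _ ⟨Y, hY, rfl⟩
  refine (hΩ.cyclic n).eq_of_inner_right (𝕜 := ℂ) ?_
  rintro _ ⟨X, hX, rfl⟩
  -- `X` and `Y` commute with every `A i`, so testing on `X* C Y` yields the matrix element of `A i*
  -- C A i` between the vectors `X Ω` and `Y Ω`, which are dense.
  let Z : N.alg := ⟨star X * (C : H →L[ℂ] H) * Y, mul_mem (mul_mem (star_mem ⟨n + 1, hX.2⟩) C.2)
    ⟨n + 1, hY.2⟩⟩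
  have e := LinearMap.congr_fun h Z
  have comm (i : ι) : N.excitation Ω (A i) Z
      = inner ℂ (X Ω) ((star (A i : H →L[ℂ] H) * (C : H →L[ℂ] H) * A i) (Y Ω)) := by
    have hXc := fun v : H => congrArg (fun T : H →L[ℂ] H => T v)
      (VonNeumannAlgebra.mem_commutant_iff.1 hX.1 _ (hA i))
    have hYc := fun v : H => congrArg (fun T : H →L[ℂ] H => T v)
      (VonNeumannAlgebra.mem_commutant_iff.1 hY.1 _ (hA i))
    rw [excitation_apply]
    simp only [mul_apply_eq_comp] at hXc hYc
    simp [Z, ContinuousLinearMap.star_eq_adjoint, ContinuousLinearMap.adjoint_inner_right, hXc, hYc]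
  simp only [LinearMap.sum_apply, LinearMap.smul_apply, comm, LinearMap.zero_apply,
    smul_eq_mul] at e
  simpa [inner_sum, inner_smul_right, sum_apply] using e

theorem norm_apply_eq_one (N : Funnel H) {Ω : H} {A : N.alg} (hA : N.excitation Ω A 1 = 1) :
    ‖(A : H →L[ℂ] H) Ω‖ = 1 := by
  rw [excitation_apply] at hA
  have h : ‖(A : H →L[ℂ] H) Ω‖ = 1 ∨ ‖(A : H →L[ℂ] H) Ω‖ = -1 := by
    simpa [inner_self_eq_norm_sq_to_K, ← Complex.ofReal_pow] using hA
  exact h.resolve_right (by linarith [norm_nonneg ((A : H →L[ℂ] H) Ω)])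

theorem excitation_apply_one_of_norm (N : Funnel H) {Ω : H} {A : N.alg}
    (hA : ‖(A : H →L[ℂ] H) Ω‖ = 1) : N.excitation Ω A 1 = 1 := by
  rw [excitation_apply]
  simp [hA, inner_self_eq_norm_sq_to_K]

theorem isOrthogonal_iff (N : Funnel H) {Ω : H} (hΩ : N.IsGeneric Ω) (A B : N.alg)
    (hA : N.excitation Ω A 1 = 1) (hB : N.excitation Ω B 1 = 1) :
    N.IsOrthogonal Ω ⟨N.excitation Ω A, A, rfl, hA⟩ ⟨N.excitation Ω B, B, rfl, hB⟩
      ↔ inner ℂ ((A : H →L[ℂ] H) Ω) ((B : H →L[ℂ] H) Ω) = 0 := by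
  rw [IsOrthogonal, N.transitionProb_eq hΩ A B hA hB, state_star_mul]
  simp

theorem exists_eq_excitation (N : Funnel H) {Ω : H} (φ : N.excitations Ω) :
    ∃ (A : N.alg) (hA : N.excitation Ω A 1 = 1), φ = ⟨N.excitation Ω A, A, rfl, hA⟩ := by
  obtain ⟨_, A, rfl, hA⟩ := φ
  exact ⟨A, hA, rfl⟩

/-- Mutually orthogonal states are represented by linearly independent operators. -/
theorem linearIndependent_of_orthonormal (N : Funnel H) {Ω : H} {ι : Type*} {A : ι → N.alg}
    (h : Orthonormal ℂ fun i => (A i : H →L[ℂ] H) Ω) : LinearIndependent ℂ A :=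
  LinearIndependent.of_comp
    ((ContinuousLinearMap.apply ℂ H Ω).toLinearMap ∘ₗ N.alg.toSubalgebra.toSubmodule.subtype)
    h.linearIndependent

/-- The coefficients of a positive functional with respect to linearly independent operators are
nonnegative. -/
theorem coeff_nonneg (N : Funnel H) {Ω : H} (hΩ : N.IsGeneric Ω) {ι κ : Type*} [Fintype ι]
    [Fintype κ] {r : ι → ℝ} {p : κ → ℝ} (hp : ∀ k, 0 ≤ p k) {A : ι → N.alg} {B : κ → N.alg}
    (hA : LinearIndependent ℂ A)
    (h : ∑ i, (r i : ℂ) • N.excitation Ω (A i) = ∑ k, (p k : ℂ) • N.excitation Ω (B k))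
    (i : ι) : 0 ≤ r i := by
  obtain ⟨n, hn⟩ := N.exists_forall_mem_loc (Sum.elim A B)
  obtain ⟨K, _, _, _, -, ⟨π⟩⟩ := N.typeI n
  let a : ι → (N.loc n).toStarSubalgebra := fun i => ⟨A i, hn (.inl i)⟩
  let b : κ → (N.loc n).toStarSubalgebra := fun k => ⟨B k, hn (.inr k)⟩
  have ha : LinearIndependent ℂ a := by
    refine Fintype.linearIndependent_iff.2 fun g hg => Fintype.linearIndependent_iff.1 hA g ?_
    have e := congrArg Subtype.val hg
    refine Subtype.ext ?_
    simpa [a] using e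
  let L : (N.loc n).toStarSubalgebra →ₗ[ℂ] (K →L[ℂ] K) :=
    { toFun := π, map_add' := map_add π, map_smul' := map_smul π }
  refine nonneg_of_sum_star_mul_mul_eq hp (a := fun i => π (a i)) (b := fun k => π (b k)) ?_
    (fun D => ?_) i
  · exact ha.map' L (LinearMap.ker_eq_bot.2 π.injective)
  · have e := N.sum_star_mul_mul_eq_zero hΩ
      (Sum.elim (fun i => (r i : ℂ)) fun k => -(p k : ℂ)) (Sum.elim A B)
      (by simp only [Fintype.sum_sum_type, Sum.elim_inl, Sum.elim_inr, h, neg_smul,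
        Finset.sum_neg_distrib, add_neg_cancel]) ⟨(π.symm D : H →L[ℂ] H), n, (π.symm D).2⟩
    have e1 := congrArg Subtype.val e
    have e2 : ∑ i, (r i : ℂ) • (star (a i) * π.symm D * a i)
        = ∑ k, (p k : ℂ) • (star (b k) * π.symm D * b k) := by
      rw [← sub_eq_zero]
      refine Subtype.ext ?_
      simpa [sub_eq_add_neg, a, b] using e1
    have hL (x : (N.loc n).toStarSubalgebra) : L (star x * π.symm D * x) = star (π x) * D * π x := by
      change π _ = _
      rw [map_mul, map_mul, map_star, StarAlgEquiv.apply_symm_apply]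
    simpa only [map_sum, map_smul, hL] using congrArg L e2

theorem exists_sum_of_mem_conv (N : Funnel H) {Ω : H} {ψ : N.alg →ₗ[ℂ] ℂ} (hψ : ψ ∈ N.conv Ω) :
    ∃ (κ : Type) (_ : Fintype κ) (p : κ → ℝ) (B : κ → N.alg), (∀ k, 0 ≤ p k) ∧ ∑ k, p k = 1 ∧
      (∀ k, N.excitation Ω (B k) 1 = 1) ∧ ψ = ∑ k, (p k : ℂ) • N.excitation Ω (B k) := by
  obtain ⟨κ, _, p, z, hp, hp1, hz, rfl⟩ := mem_convexHull_iff_exists_fintype.1 hψ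
  choose B hB hB1 using hz
  refine ⟨κ, inferInstance, p, B, hp, hp1, hB1, Finset.sum_congr rfl fun k _ => ?_⟩
  rw [hB k]
  rfl

theorem conv_subset_stateSpan (N : Funnel H) {Ω : H} {ψ : N.alg →ₗ[ℂ] ℂ} (hψ : ψ ∈ N.conv Ω) :
    ψ ∈ N.stateSpan Ω := by
  obtain ⟨κ, _, p, B, -, -, hB, rfl⟩ := N.exists_sum_of_mem_conv hψ
  exact Submodule.sum_mem _ fun k _ => Submodule.smul_mem _ _
    (Submodule.subset_span ⟨B k, rfl, hB k⟩)

theorem dagger_eq_of_mem_conv (N : Funnel H) {Ω : H} {ψ : N.alg →ₗ[ℂ] ℂ} (hψ : ψ ∈ N.conv Ω) :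
    N.dagger ψ = ψ := by
  obtain ⟨κ, _, p, B, -, -, -, rfl⟩ := N.exists_sum_of_mem_conv hψ
  simp only [map_sum, LinearMap.map_smulₛₗ, dagger_excitation, Complex.conj_ofReal]

/-- Self-adjoint elements of the span of the states are real linear combinations of states. -/
theorem exists_real_sum (N : Funnel H) {Ω : H} {ψ : N.alg →ₗ[ℂ] ℂ} (hψ : ψ ∈ N.stateSpan Ω)
    (hd : N.dagger ψ = ψ) :
    ∃ (K : ℕ) (r : Fin K → ℝ) (A : Fin K → N.alg),
      ψ = ∑ k, (r k : ℂ) • N.excitation Ω (A k) := by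
  obtain ⟨K, c, g, hg⟩ := Submodule.mem_span_set'.1 hψ
  choose A hA _ using fun k => (g k).2
  simp_rw [hA] at hg
  refine ⟨K, fun k => (c k).re, A, ?_⟩
  have h1 := N.dagger_sum Ω c A
  rw [hg, hd] at h1
  -- Write `2ψ = ψ + ψ†` and combine `c k` with its conjugate.
  have h2 : (2 : ℂ) • ψ = ∑ k, (2 : ℂ) • ((c k).re : ℂ) • N.excitation Ω (A k) := by
    rw [two_smul]
    nth_rewrite 1 [← hg]
    rw [h1, ← Finset.sum_add_distrib]
    refine Finset.sum_congr rfl fun k _ => ?_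
    rw [← add_smul, smul_smul]
    congr 1
    simpa using Complex.add_conj (c k)
  rw [← Finset.smul_sum] at h2
  exact smul_right_injective _ (two_ne_zero (α := ℂ)) h2

theorem exists_orthogonal_decomposition (N : Funnel H) {Ω : H} (hΩ : N.IsGeneric Ω)
    {ψ : N.alg →ₗ[ℂ] ℂ} (hψ : ψ ∈ N.stateSpan Ω) (hd : N.dagger ψ = ψ) :
    ∃ (M : ℕ) (φ : Fin M → N.excitations Ω) (r : Fin M → ℝ),
      (∀ m k, m ≠ k → N.IsOrthogonal Ω (φ m) (φ k)) ∧
      ψ = ∑ m, (r m : ℂ) • (φ m : N.alg →ₗ[ℂ] ℂ) := by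
  obtain ⟨K, r, A, rfl⟩ := N.exists_real_sum hψ hd
  obtain ⟨M, e, s, he, hespan, hs⟩ :=
    exists_orthonormal_sum_inner_eq (fun k => (A k : H →L[ℂ] H) Ω) r
  let ev : N.alg →ₗ[ℂ] H :=
    (ContinuousLinearMap.apply ℂ H Ω).toLinearMap ∘ₗ N.alg.toSubalgebra.toSubmodule.subtype
  -- This puts the eigenvectors in the orbit of `Ω` under the algebra, so they define states in
  -- `ω_𝒩`.
  have hle : Submodule.span ℂ (Set.range fun k => (A k : H →L[ℂ] H) Ω) ≤ LinearMap.range ev := by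
    rw [Submodule.span_le]
    rintro _ ⟨k, rfl⟩
    exact ⟨A k, rfl⟩
  choose B hB using fun m => hle (hespan m)
  replace hB : ∀ m, (B m : H →L[ℂ] H) Ω = e m := hB
  have hB1 (m) : N.excitation Ω (B m) 1 = 1 :=
    N.excitation_apply_one_of_norm (by rw [hB, he.norm_eq_one])
  refine ⟨M, fun m => ⟨N.excitation Ω (B m), B m, rfl, hB1 m⟩, s, fun m k hmk => ?_, ?_⟩
  · rw [N.isOrthogonal_iff hΩ _ _ (hB1 m) (hB1 k), hB, hB]
    exact he.inner_eq_zero hmk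
  · refine LinearMap.ext fun C => ?_
    simpa [sum_apply, excitation_apply, hB] using hs C

theorem nonneg_and_sum_eq_one (N : Funnel H) {Ω : H} (hΩ : N.IsGeneric Ω)
    {ψ : N.alg →ₗ[ℂ] ℂ} (hψ : ψ ∈ N.conv Ω) {M : ℕ} {φ : Fin M → N.excitations Ω}
    {r : Fin M → ℝ} (hφ : ∀ m k, m ≠ k → N.IsOrthogonal Ω (φ m) (φ k))
    (h : ψ = ∑ m, (r m : ℂ) • (φ m : N.alg →ₗ[ℂ] ℂ)) : (∀ m, 0 ≤ r m) ∧ ∑ m, r m = 1 := by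
  obtain ⟨κ, _, p, B, hp, hp1, hB, rfl⟩ := N.exists_sum_of_mem_conv hψ
  choose A hA hφA using fun m => N.exists_eq_excitation (φ m)
  obtain rfl := funext hφA
  constructor
  · refine N.coeff_nonneg hΩ hp (N.linearIndependent_of_orthonormal
      ⟨fun m => N.norm_apply_eq_one (hA m), fun m k hmk => ?_⟩) h.symm
    exact (N.isOrthogonal_iff hΩ _ _ (hA m) (hA k)).1 (hφ m k hmk)
  -- Every state is 1 at the identity, so evaluating there compares the two coefficient sums.
  · have e := LinearMap.congr_fun h 1
    simp only [LinearMap.sum_apply, LinearMap.smul_apply, hA, hB, smul_eq_mul, mul_one] at e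
    rw [← hp1]
    exact_mod_cast e.symm

end Funnel

theorem mainTheorem6 {H : Type u} [NormedAddCommGroup H] [InnerProductSpace ℂ H] [CompleteSpace H]
    (N : Funnel H) (Ω : H) (hΩ : N.IsGeneric Ω) :
    (∀ ψ ∈ N.stateSpan Ω, N.dagger ψ = ψ →
      ∃ (M : ℕ) (φ : Fin M → N.excitations Ω) (r : Fin M → ℝ),
        (∀ m k, m ≠ k → N.IsOrthogonal Ω (φ m) (φ k)) ∧
        ψ = ∑ m, (r m : ℂ) • (φ m : N.alg →ₗ[ℂ] ℂ)) ∧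
    (∀ ψ ∈ N.conv Ω, ∀ (M : ℕ) (φ : Fin M → N.excitations Ω) (r : Fin M → ℝ),
      (∀ m k, m ≠ k → N.IsOrthogonal Ω (φ m) (φ k)) →
      ψ = ∑ m, (r m : ℂ) • (φ m : N.alg →ₗ[ℂ] ℂ) →
      (∀ m, 0 ≤ r m) ∧ ∑ m, r m = 1) ∧
    (∀ ψ ∈ N.conv Ω, ∃ (M : ℕ) (φ : Fin M → N.excitations Ω) (r : Fin M → ℝ),
      (∀ m k, m ≠ k → N.IsOrthogonal Ω (φ m) (φ k)) ∧
      (∀ m, 0 ≤ r m) ∧ ∑ m, r m = 1 ∧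
      ψ = ∑ m, (r m : ℂ) • (φ m : N.alg →ₗ[ℂ] ℂ)) :=
  ⟨fun _ hψ hd => N.exists_orthogonal_decomposition hΩ hψ hd,
    fun _ hψ _ _ _ hφ h => N.nonneg_and_sum_eq_one hΩ hψ hφ h,
    fun _ hψ =>
      have ⟨M, φ, r, hφ, h⟩ := N.exists_orthogonal_decomposition hΩ (N.conv_subset_stateSpan hψ)
        (N.dagger_eq_of_mem_conv hψ)
      have ⟨hr, hr1⟩ := N.nonneg_and_sum_eq_one hΩ hψ hφ h
      ⟨M, φ, r, hφ, hr, hr1, h⟩⟩
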